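/- It is undecidable, given a linear context-free language $L$ (presented by a linear context-free grammar over a finite alphabet, i.e. a context-free grammar in which every production has at most one nonterminal on its right-hand side), whether $ww^r\in L$ for some word $w$, where $w^r$ denotes the reversal of $w$. Likewise, it is undecidable, given a linear context-free language $L$ presented in this way, whether $L$ contains a palindrome, i.e. a word $w$ with $w=w^r$. -/

import Mathlib

/-- A production with at most one nonterminal on its right-hand side.  Terminals and nonterminals
are named by natural numbers.  The production is `lhs → left` if `tail = none`, and
`lhs → left B right` if `tail = some (B, right)`. -/
structure LinearRule where
  lhs : ℕ
  left : List ℕ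
  tail : Option (ℕ × List ℕ)

/-- A linear context-free grammar given as finite data: a start symbol and a finite list of linear
productions.  Its (finite) terminal alphabet and its (finite) set of nonterminals consist of the
symbols that occur in it; there is no bound on their number. -/
structure LinearGrammar where
  start : ℕ
  rules : List LinearRule

namespace LinearRule

def equivProd : LinearRule ≃ ℕ × List ℕ × Option (ℕ × List ℕ) where
  toFun r := (r.lhs, r.left, r.tail)
  invFun p := ⟨p.1, p.2.1, p.2.2⟩
  left_inv _ := rfl
  right_inv _ := rfl

/-- The standard effective coding of productions, as tuples. -/
instance : Primcodable LinearRule := Primcodable.ofEquiv _ equivProd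

/-- The right-hand side, as a word of terminals and nonterminals. -/
def rhs (r : LinearRule) : List (Symbol ℕ ℕ) :=
  match r.tail with
  | none => r.left.map Symbol.terminal
  | some (B, right) =>
      r.left.map Symbol.terminal ++ [Symbol.nonterminal B] ++ right.map Symbol.terminal

/-- The production as a context-free rule. -/
def toContextFreeRule (r : LinearRule) : ContextFreeRule ℕ ℕ := ⟨r.lhs, r.rhs⟩

end LinearRule

namespace LinearGrammar

def equivProd : LinearGrammar ≃ ℕ × List LinearRule where
  toFun G := (G.start, G.rules)
  invFun p := ⟨p.1, p.2⟩
  left_inv _ := rfl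
  right_inv _ := rfl

/-- The standard effective coding of linear grammars, as tuples and lists. -/
instance : Primcodable LinearGrammar := Primcodable.ofEquiv _ equivProd

/-- The underlying context-free grammar. -/
def toContextFreeGrammar (G : LinearGrammar) : ContextFreeGrammar ℕ where
  NT := ℕ
  initial := G.start
  rules := (G.rules.map LinearRule.toContextFreeRule).toFinset

/-- The linear context-free language generated by the grammar: all terminal words that can be
derived from the start symbol. -/
def language (G : LinearGrammar) : Language ℕ := G.toContextFreeGrammar.language

end LinearGrammar

/-! Halting of the code numbered `n` on input 0 is reduced to both questions. One fixed finite
Turing machine halts on the digits of `n` iff that code does (`Turing.exists_machine_dom`). Its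
configurations are words, its moves are rewriting rules, and it halts iff the initial word rewrites
to a fixed word `y` (`eval_dom_iff_reflTransGen`).

As in Post's correspondence problem, such a rewriting exists iff pairs from a finite set can be
chosen so that the first components followed by `y #` spell the same word as `x #` followed by the
second components (`exists_flatMap_eq_iff_reflTransGen`).

A linear grammar generates the words `u 0 0 vᵣ` with `u`, `v` the two sides of such an equation. As
`0` occurs nowhere else, this word is a palindrome iff `u = v`, and it then has the form `w wᵣ`,
which settles both questions at once. Only `x` depends on `n`. -/

/-! ### Computability of binary digits. -/

theorem Nat.bits_eq_cons_of_ne_zero {n : ℕ} (hn : n ≠ 0) :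
    n.bits = n.bodd :: (n / 2).bits := by
  conv_lhs => rw [← Nat.bit_bodd_div2 n]
  rw [Nat.bits_append_bit, Nat.div2_val]
  intro h
  by_contra hb
  apply hn
  rw [← Nat.bit_bodd_div2 n, h]
  simpa using hb

theorem Primrec.nat_bits : Primrec Nat.bits := by
  -- Course-of-values recursion: `l` lists the digits of all numbers below `n = l.length`, so entry
  -- `n / 2` holds the digits that follow the lowest one.
  let g : Unit → List (List Bool) → Option (List Bool) := fun _ l =>
    if l.length = 0 then some []
    else (l[l.length / 2]?).map fun t => l.length.bodd :: t
  have hg : Primrec₂ g := by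
    have hlen : Primrec fun x : Unit × List (List Bool) => x.2.length :=
      Primrec.list_length.comp Primrec.snd
    refine Primrec.ite (Primrec.eq.comp hlen (Primrec.const 0)) (Primrec.const _) ?_
    refine Primrec.option_map
      (Primrec.list_getElem?.comp Primrec.snd
        (Primrec.nat_div.comp hlen (Primrec.const 2))) ?_
    exact Primrec.list_cons.comp (Primrec.nat_bodd.comp (hlen.comp Primrec.fst)) Primrec.snd
  have := Primrec.nat_strong_rec (fun (_ : Unit) n => n.bits) hg (fun _ n => by
    by_cases hn : n = 0
    · simp [g, hn]
    · have : n / 2 < n := by omega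
      simp [g, hn, this, Nat.bits_eq_cons_of_ne_zero hn])
  exact this.comp (Primrec.const ()) Primrec.id

/-! ### From partial recursive functions to finite Turing machines. -/

namespace Turing

open PartrecToTM2 in
/-- The digit of the machine alphabet that stands for a bit. -/
def bitDigit (b : Bool) : PartrecToTM2.Γ' := cond b Γ'.bit1 Γ'.bit0

theorem trPosNum_eq_bits (m : PosNum) :
    PartrecToTM2.trPosNum m = (m : ℕ).bits.map bitDigit := by
  induction m with
  | one => simp [PartrecToTM2.trPosNum, bitDigit]
  | bit0 m ih =>
    have h : ((PosNum.bit0 m : PosNum) : ℕ) = 2 * (m : ℕ) := by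
      rw [PosNum.cast_bit0]; omega
    rw [h, Nat.bit0_bits _ (PosNum.cast_pos (α := ℕ) m).ne']
    simp [PartrecToTM2.trPosNum, bitDigit, ih]
  | bit1 m ih =>
    have h : ((PosNum.bit1 m : PosNum) : ℕ) = 2 * (m : ℕ) + 1 := by
      rw [PosNum.cast_bit1]; omega
    rw [h, Nat.bit1_bits]
    simp [PartrecToTM2.trPosNum, bitDigit, ih]

theorem trNat_eq_bits (n : ℕ) : PartrecToTM2.trNat n = n.bits.map bitDigit := by
  rw [PartrecToTM2.trNat]
  conv_rhs => rw [← Num.to_of_nat n]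
  cases (n : Num) with
  | zero => simp [PartrecToTM2.trNum]
  | pos m => simpa [PartrecToTM2.trNum] using trPosNum_eq_bits m

/-- Restricting a machine to a set of states that supports it. -/
theorem TM0.exists_finite_machine {Γ Λ : Type} [Inhabited Γ] [Inhabited Λ]
    (M : TM0.Machine Γ Λ) (S : Finset Λ) (hS : TM0.Supports M S) :
    ∃ (Λ' : Type) (_ : Inhabited Λ') (_ : Finite Λ') (M' : TM0.Machine Γ Λ'),
      ∀ l, (StateTransition.eval (TM0.step M') (TM0.init l)).Dom ↔ (TM0.eval M l).Dom := by
  classical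
  let d : S := ⟨default, hS.1⟩
  let _ : Inhabited S := ⟨d⟩
  let g : PointedMap Λ S := ⟨fun q => if h : q ∈ S then ⟨q, h⟩ else d, dif_pos (show default ∈ S from hS.1)⟩
  let i : PointedMap Γ Γ := ⟨id, rfl⟩
  refine ⟨S, ⟨d⟩, inferInstance, M.map i i g Subtype.val, fun l => ?_⟩
  have hr := TM0.Machine.map_respects M i i g Subtype.val hS (fun _ => rfl)
    (fun q hq => by
      have : q ∈ S := hq
      change ((if h : q ∈ S then ⟨q, h⟩ else d : S) : Λ) = q
      rw [dif_pos this])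
  refine (StateTransition.tr_eval_dom hr (a₁ := TM0.init l) ⟨hS.1, ?_⟩).trans Iff.rfl
  have h := TM0.map_init i g l
  rwa [show l.map i = l from List.map_id l] at h

/-- Every partial recursive function has the same domain as a Turing machine with finitely many
states and symbols, started on the binary digits of the input behind a fixed symbol. -/
theorem exists_machine_dom {f : ℕ →. ℕ} (hf : Partrec f) :
    ∃ (Γ Λ : Type) (_ : Inhabited Γ) (_ : Inhabited Λ) (_ : Finite Γ) (_ : Finite Λ)
      (M : TM0.Machine Γ Λ) (a : Γ) (d : Bool → Γ), ∀ n,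
      (StateTransition.eval (TM0.step M) (TM0.init (a :: (n.bits.map d).reverse))).Dom ↔
        (f n).Dom := by
  obtain ⟨c, hc⟩ := ToPartrec.Code.exists_code (Nat.Partrec'.part_iff₁.2 hf)
  -- Machines start in the default state, so the default is chosen to be the entry label of `c`.
  let _ : Inhabited PartrecToTM2.Λ' := ⟨PartrecToTM2.trNormal c PartrecToTM2.Cont'.halt⟩
  have h2 := PartrecToTM2.tr_supports c PartrecToTM2.Cont'.halt
  have h1 := TM2to1.tr_supports PartrecToTM2.tr h2
  have h0 := TM1to0.tr_supports (TM2to1.tr PartrecToTM2.tr) h1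
  obtain ⟨Λ, i1, i2, M, hM⟩ := TM0.exists_finite_machine _ _ h0
  let up : PartrecToTM2.Γ' → TM2to1.Γ' PartrecToTM2.K' (fun _ => PartrecToTM2.Γ') :=
    fun a => (false, Function.update (fun _ => none) PartrecToTM2.K'.main (some a))
  have : Finite PartrecToTM2.K' := Finite.of_injective
    (fun k => match k with
      | .main => (0 : Fin 4)
      | .rev => 1
      | .aux => 2
      | .stack => 3)
    (by intro a b; cases a <;> cases b <;> simp)
  have : Finite (TM2to1.Γ' PartrecToTM2.K' fun _ => PartrecToTM2.Γ') :=
    inferInstanceAs (Finite (Bool × (PartrecToTM2.K' → Option PartrecToTM2.Γ')))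
  refine ⟨_, Λ, inferInstance, i1, inferInstance, i2, M, (true, (up PartrecToTM2.Γ'.cons).2),
    fun b => up (bitDigit b), fun n => ?_⟩
  -- The stack is laid out from the bottom: the terminator `cons` comes first, with the bottom flag
  -- `true`, and the digits follow in reverse.
  have hin : ((true, (up PartrecToTM2.Γ'.cons).2) :: (n.bits.map fun b => up (bitDigit b)).reverse)
      = TM2to1.trInit PartrecToTM2.K'.main (PartrecToTM2.trList [n]) := by
    have h : (PartrecToTM2.trList [n]).reverse =
        PartrecToTM2.Γ'.cons :: (n.bits.map bitDigit).reverse := by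
      simp [PartrecToTM2.trList, trNat_eq_bits]
    rw [TM2to1.trInit, h, ← List.map_reverse, ← List.map_reverse]
    change _ = (true, (up PartrecToTM2.Γ'.cons).2) :: (n.bits.reverse.map bitDigit).map up
    rw [List.map_map]
    rfl
  have hinit : (TM2.init PartrecToTM2.K'.main (PartrecToTM2.trList [n]) : PartrecToTM2.Cfg') =
      PartrecToTM2.init c [n] := by
    simp only [TM2.init, PartrecToTM2.init]
    congr 1
    funext k
    cases k <;> rfl
  have h2 : (TM2.eval PartrecToTM2.tr PartrecToTM2.K'.main (PartrecToTM2.trList [n])).Dom ↔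
      (f n).Dom := by
    change (StateTransition.eval (TM2.step PartrecToTM2.tr)
      (TM2.init PartrecToTM2.K'.main (PartrecToTM2.trList [n]))).Dom ↔ _
    rw [hinit, PartrecToTM2.tr_eval]
    have := hc ⟨[n], rfl⟩
    rw [show ToPartrec.Code.eval c [n] = _ from this]
    exact Iff.rfl
  have h1 := (TM2to1.tr_eval_dom PartrecToTM2.tr PartrecToTM2.K'.main
    (PartrecToTM2.trList [n])).trans h2
  have h0 := (iff_of_eq (congrArg Part.Dom (TM1to0.tr_eval (TM2to1.tr PartrecToTM2.tr)
    (TM2to1.trInit PartrecToTM2.K'.main (PartrecToTM2.trList [n]))))).trans h1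
  rw [← hin] at h0
  exact (hM _).trans h0

end Turing

/-- One step of rewriting a factor of a word by the rules in `R`. -/
def RewriteStep {α : Type*} (R : List α → List α → Prop) (w w' : List α) : Prop :=
  ∃ p u v s, R u v ∧ w = p ++ u ++ s ∧ w' = p ++ v ++ s

/-! ### Simulation of a machine by word rewriting. -/

namespace Turing.TM0

open Relation

/-- The letters of the words that describe configurations of a machine. -/
inductive Letter (Γ Λ : Type) where
  | tape (a : Γ)
  | head (q : Λ) (a : Γ)
  | left
  | right
  | halted

variable {Γ Λ : Type}

instance [Finite Γ] [Finite Λ] : Finite (Letter Γ Λ) := by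
  let f : Letter Γ Λ → Γ ⊕ (Λ × Γ) ⊕ Fin 3
    | .tape a => .inl a
    | .head q a => .inr (.inl (q, a))
    | .left => .inr (.inr 0)
    | .right => .inr (.inr 1)
    | .halted => .inr (.inr 2)
  exact Finite.of_injective f (by intro a b; cases a <;> cases b <;> simp [f])

open Letter

/-- The word `left, …, head, …, right` describing the tape contents around the head. -/
def word (l : List Γ) (q : Λ) (a : Γ) (r : List Γ) : List (Letter Γ Λ) :=
  left :: l.reverse.map tape ++ head q a :: (r.map tape ++ [right])

/-- The accepting word. -/
def haltedWord : List (Letter Γ Λ) := [left, halted, right]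

/-- The head letter occurs only once, so it can be located in only one way. -/
theorem word_eq_append {l r : List Γ} {q q₀ : Λ} {a a₀ : Γ} {x z : List (Letter Γ Λ)}
    (h : word l q a r = x ++ head q₀ a₀ :: z) :
    x = .left :: l.reverse.map tape ∧ q₀ = q ∧ a₀ = a ∧ z = r.map tape ++ [.right] := by
  rw [word, List.append_cons_inj_of_notMem (by simp) (by simp)] at h
  obtain ⟨rfl, h, rfl⟩ := h
  cases h
  simp

variable [Inhabited Γ] [Inhabited Λ]

/-- The configuration described by `word l q a r`. -/
def wordCfg (l : List Γ) (q : Λ) (a : Γ) (r : List Γ) : Cfg Γ Λ :=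
  ⟨q, ⟨a, ListBlank.mk l, ListBlank.mk r⟩⟩

/-- The rewriting rules that simulate a machine and shrink halted configurations. -/
inductive Rule (M : Machine Γ Λ) : List (Letter Γ Λ) → List (Letter Γ Λ) → Prop
  | write {q a q' b} : M q a = some (q', .write b) → Rule M [head q a] [head q' b]
  | right {q a q'} (b) : M q a = some (q', .move .right) →
      Rule M [head q a, tape b] [tape a, head q' b]
  | rightBlank {q a q'} : M q a = some (q', .move .right) →
      Rule M [head q a, right] [tape a, head q' default, right]
  | left {q a q'} (b) : M q a = some (q', .move .left) →
      Rule M [tape b, head q a] [head q' b, tape a]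
  | leftBlank {q a q'} : M q a = some (q', .move .left) →
      Rule M [left, head q a] [left, head q' default, tape a]
  | halt {q a} : M q a = none → Rule M [head q a] [halted]
  | eraseLeft (b) : Rule M [tape b, halted] [halted]
  | eraseRight (b) : Rule M [halted, tape b] [halted]

theorem Rule.length_le {M : Machine Γ Λ} {u v : List (Letter Γ Λ)} (h : Rule M u v) :
    u.length ≤ 3 ∧ v.length ≤ 3 := by
  cases h <;> simp

/-- Beyond the listed cells the tape is blank, which agrees with `headI` of the empty list being
`default`. -/
theorem step_wordCfg (M : Machine Γ Λ) (l : List Γ) (q : Λ) (a : Γ) (r : List Γ) :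
    step M (wordCfg l q a r) = (M q a).map fun x => match x.2 with
      | .write b => wordCfg l x.1 b r
      | .move .right => wordCfg (a :: l) x.1 r.headI r.tail
      | .move .left => wordCfg l.tail x.1 l.headI (a :: r) := by
  simp only [step, wordCfg]
  congr 1
  funext ⟨q', s⟩
  rcases s with (_ | _) | _ <;>
    simp [Tape.move, Tape.write, ListBlank.head_mk, ListBlank.tail_mk, ListBlank.cons_mk]

/-- Soundness: every rule applicable to a configuration word involves its only head, so determinism
of the machine leaves no freedom until it halts. The erasing rules need a `halted` letter. -/
theorem rewriteStep_word {M : Machine Γ Λ} {l r : List Γ} {q : Λ} {a : Γ}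
    {w : List (Letter Γ Λ)} (h : RewriteStep (Rule M) (word l q a r) w) :
    (∃ l' q' a' r', w = word l' q' a' r' ∧ wordCfg l' q' a' r' ∈ step M (wordCfg l q a r)) ∨
      step M (wordCfg l q a r) = none := by
  obtain ⟨p, u, v, s, hR, hw, rfl⟩ := h
  rw [step_wordCfg]
  cases hR with
  | @write q₀ a₀ q' b hM =>
    obtain ⟨rfl, rfl, rfl, rfl⟩ := word_eq_append (x := p) (z := s) (by simpa using hw)
    exact .inl ⟨l, q', b, r, by simp [word], by simp [hM]⟩
  | @right q₀ a₀ q' b hM =>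
    obtain ⟨rfl, rfl, rfl, h⟩ := word_eq_append (x := p) (z := tape b :: s) (by simpa using hw)
    cases r with
    | nil => simp at h
    | cons c r =>
      obtain ⟨rfl, rfl⟩ : b = c ∧ s = r.map tape ++ [.right] := by simpa using h
      exact .inl ⟨a₀ :: l, q', b, r, by simp [word], by simp [hM]⟩
  | @rightBlank q₀ a₀ q' hM =>
    obtain ⟨rfl, rfl, rfl, h⟩ := word_eq_append (x := p) (z := .right :: s) (by simpa using hw)
    cases r with
    | cons c r => simp at h
    | nil =>
      obtain rfl : s = [] := by simpa using h
      exact .inl ⟨a₀ :: l, q', default, [], by simp [word], by simp [hM]⟩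
  | @left q₀ a₀ q' b hM =>
    obtain ⟨h, rfl, rfl, rfl⟩ := word_eq_append (x := p ++ [tape b]) (z := s) (by simpa using hw)
    cases l with
    | nil =>
      have := congrArg List.getLast? h
      simp at this
    | cons c l =>
      rw [List.reverse_cons, List.map_append, ← List.cons_append] at h
      obtain ⟨rfl, h⟩ := List.append_inj' h rfl
      obtain rfl : b = c := by simpa using h
      exact .inl ⟨l, q', b, a₀ :: r, by simp [word], by simp [hM]⟩
  | @leftBlank q₀ a₀ q' hM =>
    obtain ⟨h, rfl, rfl, rfl⟩ := word_eq_append (x := p ++ [.left]) (z := s) (by simpa using hw)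
    cases l with
    | cons c l =>
      rw [List.reverse_cons, List.map_append, ← List.cons_append] at h
      simpa using (List.append_inj' h rfl).2
    | nil =>
      obtain rfl : p = [] := by simpa using congrArg List.length h
      exact .inl ⟨[], q', default, a₀ :: r, by simp [word], by simp [hM]⟩
  | @halt q₀ a₀ hM =>
    obtain ⟨rfl, rfl, rfl, rfl⟩ := word_eq_append (x := p) (z := s) (by simpa using hw)
    exact .inr (by simp [hM])
  | eraseLeft b =>
    have : halted ∈ word l q a r := by simp [hw]
    simp [word] at this
  | eraseRight b =>
    have : halted ∈ word l q a r := by simp [hw]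
    simp [word] at this

theorem exists_rewriteStep_word {M : Machine Γ Λ} {l r : List Γ} {q : Λ} {a : Γ}
    {c : Cfg Γ Λ} (h : c ∈ step M (wordCfg l q a r)) :
    ∃ l' q' a' r', c = wordCfg l' q' a' r' ∧
      RewriteStep (Rule M) (word l q a r) (word l' q' a' r') := by
  rw [step_wordCfg] at h
  obtain ⟨⟨q', s⟩, hM, rfl⟩ := Option.map_eq_some_iff.1 h
  rcases s with (_ | _) | b
  · refine ⟨_, _, _, _, rfl, ?_⟩
    cases l with
    | nil => exact ⟨[], _, _, _, .leftBlank hM, by simp [word]; rfl, by simp [word]⟩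
    | cons b l =>
      exact ⟨.left :: l.reverse.map tape, _, _, _, .left b hM, by simp [word]; rfl, by simp [word]⟩
  · refine ⟨_, _, _, _, rfl, ?_⟩
    cases r with
    | nil =>
      exact ⟨.left :: l.reverse.map tape, _, _, [], .rightBlank hM, by simp [word], by simp [word]⟩
    | cons b r =>
      exact ⟨.left :: l.reverse.map tape, _, _, r.map tape ++ [.right], .right b hM,
        by simp [word], by simp [word]⟩
  · exact ⟨_, _, _, _, rfl, .left :: l.reverse.map tape, _, _, r.map tape ++ [.right], .write hM,
      by simp [word], by simp [word]⟩

theorem reflTransGen_eraseLeft (M : Machine Γ Λ) (l : List Γ) (t : List (Letter Γ Λ)) :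
    ReflTransGen (RewriteStep (Rule M)) (left :: l.reverse.map tape ++ halted :: t)
      (left :: halted :: t) := by
  induction l with
  | nil => exact .refl
  | cons b l ih =>
    exact .head ⟨left :: l.reverse.map tape, _, _, t, .eraseLeft b, by simp, by simp⟩ ih

theorem reflTransGen_eraseRight (M : Machine Γ Λ) (r : List Γ) (t : List (Letter Γ Λ)) :
    ReflTransGen (RewriteStep (Rule M)) (left :: halted :: (r.map tape ++ t))
      (left :: halted :: t) := by
  induction r with
  | nil => exact .refl
  | cons b r ih =>
    exact .head ⟨[left], _, _, r.map tape ++ t, .eraseRight b, by simp, by simp⟩ ih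

/-- The machine halts from a configuration iff its word can be rewritten to the accepting word. -/
theorem eval_dom_iff_reflTransGen (M : Machine Γ Λ) (l : List Γ) (q : Λ) (a : Γ) (r : List Γ) :
    (StateTransition.eval (step M) (wordCfg l q a r)).Dom ↔
      ReflTransGen (RewriteStep (Rule M)) (word l q a r) haltedWord := by
  rw [Part.dom_iff_mem]
  simp only [StateTransition.mem_eval]
  constructor
  · rintro ⟨c, hc, hn⟩
    suffices ∀ c₀, StateTransition.Reaches (step M) c₀ c → ∀ l q a r, c₀ = wordCfg l q a r →
        ReflTransGen (RewriteStep (Rule M)) (word l q a r) haltedWord from this _ hc _ _ _ _ rfl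
    intro c₀ h
    induction h using ReflTransGen.head_induction_on with
    | refl =>
      rintro l q a r rfl
      have hM : M q a = none := by simpa [step_wordCfg] using hn
      refine .head ⟨.left :: l.reverse.map tape, _, _, r.map tape ++ [.right], .halt hM,
        by simp [word], rfl⟩ ?_
      have h₁ := reflTransGen_eraseLeft M l (r.map tape ++ [.right])
      have h₂ := reflTransGen_eraseRight M r [.right]
      simpa [haltedWord] using h₁.trans h₂
    | head h _ ih =>
      rintro l q a r rfl
      obtain ⟨l', q', a', r', rfl, hw⟩ := exists_rewriteStep_word h
      exact .head hw (ih _ _ _ _ rfl)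
  · intro h
    suffices ∀ w : List (Letter Γ Λ), ReflTransGen (RewriteStep (Rule M)) w haltedWord →
        ∀ l q a r, w = word l q a r →
        ∃ c, StateTransition.Reaches (step M) (wordCfg l q a r) c ∧ step M c = none from
      this _ h _ _ _ _ rfl
    intro w h
    induction h using ReflTransGen.head_induction_on with
    | refl =>
      intro l q a r h
      have : head q a ∈ (haltedWord : List (Letter Γ Λ)) := by simp [h, word]
      simp [haltedWord] at this
    | head h _ ih =>
      rintro l q a r rfl
      obtain ⟨l', q', a', r', rfl, hs⟩ | hn := rewriteStep_word h
      · obtain ⟨c, hc, hn⟩ := ih _ _ _ _ rfl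
        exact ⟨c, .head hs hc, hn⟩
      · exact ⟨_, .refl, hn⟩

end Turing.TM0

/-! ### Rewriting as a matching problem for pairs of words. -/

open Relation

/-- The pairs of words over `α`, extended by a separator `none`, whose concatenations spell out
rewriting sequences: the rules, the letters, and the separator. -/
def rewritePairs {α : Type*} (R : List α → List α → Prop) :
    Set (List (Option α) × List (Option α)) :=
  {p | (∃ u v, R u v ∧ p = (u.map some, v.map some)) ∨ ∃ c, p = ([c], [c])}

section

variable {α : Type*} {R : List α → List α → Prop}

/-- Invariant of a left-to-right scan: `s` is the unread part of the current word, `p` the already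
produced part of the next one. -/
theorem reflTransGen_of_flatMap_eq {y : List α} {is : List (List (Option α) × List (Option α))}
    (his : ∀ p ∈ is, p ∈ rewritePairs R) (s p : List α)
    (h : is.flatMap Prod.fst ++ (y.map some ++ [none]) =
      s.map some ++ none :: (p.map some ++ is.flatMap Prod.snd)) :
    ReflTransGen (RewriteStep R) (p ++ s) y := by
  induction is generalizing s p with
  | nil =>
    have h' : y.map some ++ none :: [] = s.map some ++ none :: p.map some := by simpa using h
    rw [List.append_cons_inj_of_notMem (by simp) (by simp)] at h'
    obtain ⟨h₁, -, h₂⟩ := h'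
    obtain rfl := List.map_injective_iff.2 (Option.some_injective _) h₁
    obtain rfl : p = [] := by simpa using h₂.symm
    exact .refl
  | cons i is ih =>
    have hi := his i List.mem_cons_self
    replace ih := ih fun p hp => his p (List.mem_cons_of_mem _ hp)
    rcases hi with ⟨u, v, huv, rfl⟩ | ⟨_ | c, rfl⟩
    -- `u` contains no separator, so it cannot reach past the one that follows `s`.
    · obtain ⟨s, rfl⟩ : u <+: s := by
        have h₁ : u.map some <+: s.map some ++ none :: (p.map some ++ (v.map some ++ is.flatMap Prod.snd)) :=
          ⟨_, by simpa using h⟩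
        have h₂ := (List.prefix_append (s.map some)
          (none :: (p.map some ++ (v.map some ++ is.flatMap Prod.snd))))
        rcases List.prefix_or_prefix_of_prefix h₁ h₂ with h₃ | ⟨t, h₃⟩
        · exact (List.prefix_map_iff_of_injective (Option.some_injective _)).1 h₃
        · cases t with
          | nil =>
            rw [List.append_nil] at h₃
            rw [List.map_injective_iff.2 (Option.some_injective _) h₃]
          | cons c t =>
            have hc : c ∈ u.map some := by simp [← h₃]
            rw [← h₃, List.prefix_append_right_inj] at h₁
            obtain rfl : c = none := by
              obtain ⟨t', ht⟩ := h₁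
              exact (List.cons.inj ht).1
            simp at hc
      refine .head ⟨p, u, v, s, huv, by simp, rfl⟩ ?_
      simpa using ih s (p ++ v) (by simpa using h)
    -- Reading the separator forces `s` to be empty; `p` becomes the word to scan.
    · cases s with
      | nil => simpa using ih p [] (by simpa using h)
      | cons a s => simp at h
    · cases s with
      | nil => simp at h
      | cons a s =>
        obtain ⟨rfl, h⟩ : c = a ∧ _ := by simpa using h
        simpa using ih s (p ++ [c]) (by simpa using h)

/-- Reachability by rewriting as a matching problem for concatenations of pairs. -/
theorem exists_flatMap_eq_iff_reflTransGen {x y : List α} :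
    (∃ is : List (List (Option α) × List (Option α)), (∀ p ∈ is, p ∈ rewritePairs R) ∧
      is.flatMap Prod.fst ++ (y.map some ++ [none]) =
        (x.map some ++ [none]) ++ is.flatMap Prod.snd) ↔
    ReflTransGen (RewriteStep R) x y := by
  constructor
  · rintro ⟨is, his, h⟩
    simpa using reflTransGen_of_flatMap_eq his x [] (by simpa using h)
  · intro h
    induction h using ReflTransGen.head_induction_on with
    | refl => exact ⟨[], by simp, by simp⟩
    | head h _ ih =>
      obtain ⟨is, his, ih⟩ := ih
      obtain ⟨p, u, v, s, huv, rfl, rfl⟩ := h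
      let copy : List α → List (List (Option α) × List (Option α)) :=
        List.map fun a => ([some a], [some a])
      have hfst : ∀ t, (copy t).flatMap Prod.fst = t.map some := fun t => by
        induction t <;> simp_all [copy]
      have hsnd : ∀ t, (copy t).flatMap Prod.snd = t.map some := fun t => by
        induction t <;> simp_all [copy]
      have hcopy : ∀ t, ∀ i ∈ copy t, i ∈ rewritePairs R := fun t i hi => by
        obtain ⟨a, -, rfl⟩ := List.mem_map.1 hi
        exact .inr ⟨_, rfl⟩
      -- One full scan per rewriting step: the first components spell `p u s #`, the second `p v s
      -- #`.
      refine ⟨copy p ++ (u.map some, v.map some) :: (copy s ++ ([none], [none]) :: is), ?_, ?_⟩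
      · intro i hi
        simp only [List.mem_append, List.mem_cons] at hi
        rcases hi with hi | rfl | hi | rfl | hi
        · exact hcopy _ _ hi
        · exact .inl ⟨u, v, huv, rfl⟩
        · exact hcopy _ _ hi
        · exact .inr ⟨_, rfl⟩
        · exact his _ hi
      · simp only [List.flatMap_append, List.flatMap_cons, hfst, hsnd]
        simp only [List.append_assoc, List.map_append] at ih ⊢
        simp [ih]

theorem finite_rewritePairs [Finite α] (k : ℕ)
    (hR : ∀ u v, R u v → u.length ≤ k ∧ v.length ≤ k) : (rewritePairs R).Finite := by
  have hk : {l : List (Option α) | l.length ≤ k + 1}.Finite := by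
    exact List.finite_length_le _ _
  refine (hk.prod hk).subset ?_
  rintro _ (⟨u, v, huv, rfl⟩ | ⟨c, rfl⟩)
  · have := hR u v huv
    simp only [Set.mem_prod, Set.mem_ofPred_eq, List.length_map]
    omega
  · simp

end

/-! ### The linear grammar of a matching problem. -/

namespace LinearGrammar

open ContextFreeGrammar

/-- The linear grammar of the words `u 0 0 vᵣ`, where `(u, v)` is the pair `([], x)` followed by
pairs from `P` and then by `(y, [])`. Letters are named by `f`. -/
def matchGrammar {α : Type*} (f : α → ℕ) (P : List (List α × List α)) (x y : List α) :
    LinearGrammar :=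
  ⟨0, ⟨0, [], some (1, (x.map f).reverse)⟩ :: ⟨1, y.map f ++ [0, 0], none⟩ ::
    P.map fun p => ⟨1, p.1.map f, some (1, (p.2.map f).reverse)⟩⟩

theorem produces_iff {G : LinearGrammar} {u v : List (Symbol ℕ ℕ)} :
    G.toContextFreeGrammar.Produces u v ↔ ∃ r ∈ G.rules, ∃ p q : List (Symbol ℕ ℕ),
      u = p ++ [Symbol.nonterminal r.lhs] ++ q ∧ v = p ++ r.rhs ++ q := by
  have h : G.toContextFreeGrammar.Produces u v ↔
      ∃ r ∈ (G.rules.map LinearRule.toContextFreeRule).toFinset, r.Rewrites u v := Iff.rfl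
  simp only [h, List.mem_toFinset, List.mem_map, exists_exists_and_eq_and,
    ContextFreeRule.rewrites_iff]
  rfl

section

variable {α : Type*} {f : α → ℕ} {P : List (List α × List α)} {x y : List α}

/-- The word of the match grammar for a list of pairs. -/
def matchWord (f : α → ℕ) (x y : List α) (is : List (List α × List α)) : List ℕ :=
  (is.flatMap Prod.fst ++ y).map f ++ 0 :: 0 :: ((x ++ is.flatMap Prod.snd).map f).reverse

/-- The sentential form of the match grammar for a list of pairs. -/
def matchForm (f : α → ℕ) (x : List α) (is : List (List α × List α)) : List (Symbol ℕ ℕ) :=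
  ((is.flatMap Prod.fst).map f).map Symbol.terminal ++ Symbol.nonterminal 1 ::
    (((x ++ is.flatMap Prod.snd).map f).reverse).map Symbol.terminal

theorem matchForm_produces {is : List (List α × List α)} (p : List α × List α) (hp : p ∈ P) :
    (matchGrammar f P x y).toContextFreeGrammar.Produces (matchForm f x is)
      (matchForm f x (is ++ [p])) := by
  refine produces_iff.2 ⟨⟨1, p.1.map f, some (1, (p.2.map f).reverse)⟩, ?_, _, _,
    by simp only [matchForm, List.append_assoc]; rfl, ?_⟩
  · simp only [matchGrammar, List.mem_cons, List.mem_map]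
    exact .inr (.inr ⟨p, hp, rfl⟩)
  · simp [matchForm, LinearRule.rhs]

theorem derives_matchForm {is : List (List α × List α)} (his : ∀ p ∈ is, p ∈ P) :
    (matchGrammar f P x y).toContextFreeGrammar.Derives [Symbol.nonterminal (0 : ℕ)]
      (matchForm f x is) := by
  induction is using List.reverseRecOn with
  | nil =>
    refine ContextFreeGrammar.Produces.single (produces_iff.2 ⟨⟨0, [], some (1, (x.map f).reverse)⟩,
      by simp [matchGrammar], [], [], rfl, by simp [matchForm, LinearRule.rhs]⟩)
  | append_singleton is p ih =>
    exact (ih fun q hq => his q (by simp [hq])).trans_produces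
      (matchForm_produces p (his p (by simp)))

theorem map_terminal_matchWord (is : List (List α × List α)) :
    (matchWord f x y is).map (Symbol.terminal (N := ℕ)) =
      ((is.flatMap Prod.fst).map f).map Symbol.terminal ++
        LinearRule.rhs ⟨1, y.map f ++ [0, 0], none⟩ ++
        (((x ++ is.flatMap Prod.snd).map f).reverse).map Symbol.terminal := by
  simp [matchWord, LinearRule.rhs]

theorem matchWord_produces (is : List (List α × List α)) :
    (matchGrammar f P x y).toContextFreeGrammar.Produces (matchForm f x is)
      ((matchWord f x y is).map (Symbol.terminal (N := ℕ))) := by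
  exact produces_iff.2 ⟨⟨1, y.map f ++ [0, 0], none⟩, by simp [matchGrammar], _, _,
    by simp only [matchForm, List.append_assoc]; rfl, map_terminal_matchWord is⟩

theorem matchForm_eq_append {is : List (List α × List α)} {p q : List (Symbol ℕ ℕ)} {A : ℕ}
    (h : matchForm f x is = p ++ [Symbol.nonterminal A] ++ q) :
    A = 1 ∧ p = ((is.flatMap Prod.fst).map f).map Symbol.terminal ∧
      q = (((x ++ is.flatMap Prod.snd).map f).reverse).map Symbol.terminal := by
  rw [matchForm, List.append_assoc, List.singleton_append,
    List.append_cons_inj_of_notMem (by simp) (by simp)] at h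
  obtain ⟨rfl, h, rfl⟩ := h
  cases h
  exact ⟨rfl, rfl, rfl⟩

/-- Each sentential form has at most one nonterminal, so a derivation is determined by the sequence
of pairs it uses. -/
theorem exists_of_derives {s : List (Symbol ℕ ℕ)}
    (h : (matchGrammar f P x y).toContextFreeGrammar.Derives [Symbol.nonterminal (0 : ℕ)] s) :
    s = [Symbol.nonterminal 0] ∨ ∃ is : List (List α × List α), (∀ p ∈ is, p ∈ P) ∧
      (s = matchForm f x is ∨ s = (matchWord f x y is).map Symbol.terminal) := by
  induction h with
  | refl => exact .inl rfl
  | tail _ h ih =>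
    right
    obtain ⟨r, hr, p, q, hu, rfl⟩ := produces_iff.1 h
    simp only [matchGrammar, List.mem_cons, List.mem_map] at hr
    rcases ih with rfl | ⟨is, his, rfl | rfl⟩
    · rw [List.append_assoc, List.singleton_append] at hu
      obtain ⟨rfl, hA, rfl⟩ := (List.append_cons_inj_of_notMem (x₁ := []) (z₁ := [])
        (by simp) (by simp)).1 hu
      rcases hr with rfl | rfl | ⟨i, -, rfl⟩
      · exact ⟨[], by simp, .inl (by simp [matchForm, LinearRule.rhs])⟩
      · simp at hA
      · simp at hA
    · obtain ⟨hA, rfl, rfl⟩ := matchForm_eq_append hu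
      rcases hr with rfl | rfl | ⟨i, hi, rfl⟩
      · simp at hA
      · exact ⟨is, his, .inr (by simp [matchWord, LinearRule.rhs])⟩
      · refine ⟨is ++ [i], ?_, .inl (by simp [matchForm, LinearRule.rhs])⟩
        simp only [List.mem_append, List.mem_singleton]
        rintro p (hp | rfl)
        exacts [his p hp, hi]
    · have : Symbol.nonterminal r.lhs ∈ (matchWord f x y is).map (Symbol.terminal (N := ℕ)) := by
        rw [hu]; simp
      simp at this

theorem mem_language_matchGrammar {w : List ℕ} :
    w ∈ (matchGrammar f P x y).language ↔
      ∃ is : List (List α × List α), (∀ p ∈ is, p ∈ P) ∧ w = matchWord f x y is := by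
  have h : w ∈ (matchGrammar f P x y).language ↔
      (matchGrammar f P x y).toContextFreeGrammar.Derives [Symbol.nonterminal (0 : ℕ)]
        (w.map (Symbol.terminal (N := ℕ))) := Iff.rfl
  rw [h]
  constructor
  · intro h
    rcases exists_of_derives h with h | ⟨is, his, h | h⟩
    · have : Symbol.nonterminal 0 ∈ w.map (Symbol.terminal (N := ℕ)) := by
        rw [show w.map Symbol.terminal = [Symbol.nonterminal 0] from h]; simp
      simp at this
    · have : Symbol.nonterminal 1 ∈ w.map (Symbol.terminal (N := ℕ)) := by
        rw [show w.map Symbol.terminal = matchForm f x is from h]; simp [matchForm]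
      simp at this
    · exact ⟨is, his, List.map_injective_iff.2 (fun _ _ h => Symbol.terminal.inj h) h⟩
  · rintro ⟨is, his, rfl⟩
    exact (derives_matchForm his).trans_produces (matchWord_produces is)

end

/-- A word with a marker pair in it is a palindrome only if the pair is in the middle. -/
theorem palindrome_marker_iff {u v : List ℕ} (hu : 0 ∉ u) (hv : 0 ∉ v) :
    u ++ 0 :: 0 :: v.reverse = (u ++ 0 :: 0 :: v.reverse).reverse ↔ u = v := by
  constructor
  · intro h
    have h' : u ++ 0 :: (0 :: v.reverse) = v ++ 0 :: (0 :: u.reverse) := by simpa using h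
    -- If `u` and `v` had different lengths, the longer would contain the first marker of the other
    -- side.
    rw [List.append_eq_append_iff] at h'
    obtain ⟨c, rfl, h'⟩ | ⟨c, rfl, h'⟩ := h'
    · cases c with
      | nil => simp
      | cons a c =>
        obtain ⟨rfl, -⟩ := List.cons.inj h'
        simp at hv
    · cases c with
      | nil => simp
      | cons a c =>
        obtain ⟨rfl, -⟩ := List.cons.inj h'
        simp at hu
  · rintro rfl
    simp

section

variable {α : Type*} {f : α → ℕ} {P : List (List α × List α)} {x y : List α}

theorem matchWord_palindrome_iff (hf : Function.Injective f) (hf₀ : ∀ a, f a ≠ 0)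
    (is : List (List α × List α)) :
    matchWord f x y is = (matchWord f x y is).reverse ↔
      is.flatMap Prod.fst ++ y = x ++ is.flatMap Prod.snd := by
  have h (l : List α) : 0 ∉ l.map f := by
    rintro h
    obtain ⟨a, -, ha⟩ := List.mem_map.1 h
    exact hf₀ a ha
  rw [matchWord, palindrome_marker_iff (h _) (h _), (List.map_injective_iff.2 hf).eq_iff]

theorem exists_palindrome_matchGrammar_iff (hf : Function.Injective f) (hf₀ : ∀ a, f a ≠ 0) :
    (∃ w : List ℕ, w ∈ (matchGrammar f P x y).language ∧ w = w.reverse) ↔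
      ∃ is : List (List α × List α), (∀ p ∈ is, p ∈ P) ∧
        is.flatMap Prod.fst ++ y = x ++ is.flatMap Prod.snd := by
  constructor
  · rintro ⟨w, hw, hp⟩
    obtain ⟨is, his, rfl⟩ := mem_language_matchGrammar.1 hw
    exact ⟨is, his, (matchWord_palindrome_iff hf hf₀ is).1 hp⟩
  · rintro ⟨is, his, h⟩
    exact ⟨_, mem_language_matchGrammar.2 ⟨is, his, rfl⟩, (matchWord_palindrome_iff hf hf₀ is).2 h⟩

theorem exists_append_reverse_matchGrammar_iff (hf : Function.Injective f)
    (hf₀ : ∀ a, f a ≠ 0) :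
    (∃ w : List ℕ, w ++ w.reverse ∈ (matchGrammar f P x y).language) ↔
      ∃ is : List (List α × List α), (∀ p ∈ is, p ∈ P) ∧
        is.flatMap Prod.fst ++ y = x ++ is.flatMap Prod.snd := by
  constructor
  · rintro ⟨w, hw⟩
    exact (exists_palindrome_matchGrammar_iff hf hf₀).1 ⟨_, hw, by simp⟩
  · rintro ⟨is, his, h⟩
    -- The marker is doubled so that the palindrome splits between its two zeros.
    refine ⟨(is.flatMap Prod.fst ++ y).map f ++ [0], mem_language_matchGrammar.2 ⟨is, his, ?_⟩⟩
    rw [matchWord, ← h]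
    simp

end

/-- Only the start rule varies with `n`; the remaining rules are a constant list. -/
theorem computable_matchGrammar {α : Type*} (f : α → ℕ) (P : List (List α × List α))
    {x : ℕ → List α} (y : List α) (hx : Computable fun n => (x n).map f) :
    Computable fun n => matchGrammar f P (x n) y := by
  have hrule : Computable LinearRule.equivProd.symm :=
    (Primrec.of_equiv_symm (e := LinearRule.equivProd)).to_comp
  have hgrammar : Computable LinearGrammar.equivProd.symm :=
    (Primrec.of_equiv_symm (e := LinearGrammar.equivProd)).to_comp
  refine hgrammar.comp ((Computable.const 0).pair (Computable.list_cons.comp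
    (hrule.comp ((Computable.const 0).pair ((Computable.const []).pair
      (Computable.option_some.comp ((Computable.const 1).pair
        (Computable.list_reverse.comp hx))))))
    (Computable.const _)))

end LinearGrammar

/-! ### The reduction from the halting problem. -/

open Turing TM0

/-- Every partial recursive domain reduces to the match problem of linear grammars. -/
theorem exists_computable_matchGrammar {φ : ℕ →. ℕ} (hφ : Partrec φ) :
    ∃ G : ℕ → LinearGrammar, Computable G ∧ ∀ n,
      ((∃ w : List ℕ, w ++ w.reverse ∈ (G n).language) ↔ (φ n).Dom) ∧
      ((∃ w : List ℕ, w ∈ (G n).language ∧ w = w.reverse) ↔ (φ n).Dom) := by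
  obtain ⟨Γ, Λ, _, _, _, _, M, a, d, hM⟩ := exists_machine_dom hφ
  obtain ⟨g, hg⟩ := exists_injective_nat (Option (Letter Γ Λ))
  -- The shift keeps `0` free for the marker.
  let f : Option (Letter Γ Λ) → ℕ := fun c => g c + 1
  have hf : Function.Injective f := fun b c h => hg (Nat.succ.inj h)
  have hf₀ : ∀ c, f c ≠ 0 := fun c => Nat.succ_ne_zero _
  have hfin := finite_rewritePairs (R := Rule M) 3 fun u v h => h.length_le
  let P := hfin.toFinset.toList
  have hP : ∀ p, p ∈ P ↔ p ∈ rewritePairs (Rule M) := by simp [P]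
  let y : List (Option (Letter Γ Λ)) := haltedWord.map some ++ [none]
  let x : ℕ → List (Option (Letter Γ Λ)) := fun n =>
    (word [] default a (n.bits.map d).reverse).map some ++ [none]
  have hx : Computable fun n => (x n).map f := by
    have h : Primrec fun n : ℕ => [f (some .left), f (some (.head default a))] ++
        ((n.bits.map fun b => f (some (.tape (d b)))).reverse ++ [f (some .right), f none]) :=
      Primrec.list_append.comp (Primrec.const _) (Primrec.list_append.comp
        (Primrec.list_reverse.comp (Primrec.list_map Primrec.nat_bits
          ((Primrec.dom_finite fun b => f (some (.tape (d b)))).comp Primrec.snd).to₂)) (Primrec.const _))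
    refine h.to_comp.of_eq fun n => ?_
    simp [x, word, Function.comp_def]
  have key (n : ℕ) : (∃ is : List (List (Option (Letter Γ Λ)) × List (Option (Letter Γ Λ))),
      (∀ p ∈ is, p ∈ P) ∧ is.flatMap Prod.fst ++ y = x n ++ is.flatMap Prod.snd) ↔
        (φ n).Dom := by
    simp only [hP]
    rw [exists_flatMap_eq_iff_reflTransGen, ← eval_dom_iff_reflTransGen, ← hM n]
    rfl
  exact ⟨fun n => LinearGrammar.matchGrammar f P (x n) y,
    LinearGrammar.computable_matchGrammar f P y hx, fun n =>
    ⟨(LinearGrammar.exists_append_reverse_matchGrammar_iff hf hf₀).trans (key n),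
      (LinearGrammar.exists_palindrome_matchGrammar_iff hf hf₀).trans (key n)⟩⟩

theorem theorem4p12 :
    (¬ ComputablePred fun G : LinearGrammar => ∃ w : List ℕ, w ++ w.reverse ∈ G.language) ∧
    (¬ ComputablePred fun G : LinearGrammar => ∃ w : List ℕ, w ∈ G.language ∧ w = w.reverse) := by
  have hφ : Partrec fun n : ℕ => (Denumerable.ofNat Nat.Partrec.Code n).eval 0 :=
    Nat.Partrec.Code.eval_part.comp (Computable.ofNat _) (Computable.const 0)
  obtain ⟨G, hG, h⟩ := exists_computable_matchGrammar hφ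
  have hG' : Computable fun c : Nat.Partrec.Code => G (Encodable.encode c) :=
    hG.comp Computable.encode
  have h' (c : Nat.Partrec.Code) := h (Encodable.encode c)
  simp only [Denumerable.ofNat_encode] at h'
  constructor
  · intro hc
    exact ComputablePred.halting_problem 0 (ComputablePred.computable_of_manyOneReducible
      ⟨_, hG', fun c => (h' c).1.symm⟩ hc)
  · intro hc
    exact ComputablePred.halting_problem 0 (ComputablePred.computable_of_manyOneReducible
      ⟨_, hG', fun c => (h' c).2.symm⟩ hc)
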